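/- Let $X_0,\dots,X_m$ be arbitrary random variables on a common probability space, and write $\mathbf X_i=(X_0,\dots,X_i)$. Let $Z_0=0$ and let $Z_1,\dots,Z_m$ be random variables on the same space whose values are Hermitian (complex) $n\times n$ matrices. Assume the martingale condition $$\mathbb E[Z_i\mid \mathbf X_{i-1}]=Z_{i-1}\quad\text{almost surely, for } i=1,\dots,m,$$ and assume that the differences $D_i=Z_i-Z_{i-1}$ satisfy, for $i=1,\dots,m$ and almost surely, $$\|D_i\|\le c_i,\qquad \big\|\mathbb E[D_i^2\mid \mathbf X_{i-1}]\big\|\le\sigma_i^2,$$ where $c_i,\sigma_i$ are real constants and $\|\cdot\|$ is the operator (spectral) norm. Let $V=\sum_{i=1}^m\sigma_i^2$. Then $$\Pr\big[\|Z_m\|>t\big]\le 2n\exp\Big(-\frac{t^2}{4V}\Big)$$ for every $t$ with $0\le t\le 2V/\max_i c_i$, i.e. for every $t\ge 0$ with $t\,c_i\le 2V$ for all $i$ (if $V=0$, the exponential is read as $1$). -/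

import Mathlib

open MeasureTheory
open scoped Matrix.Norms.L2Operator

/-- The σ-algebra generated by the random variables `X 0, …, X i`. -/
abbrev sigmaPast {Ω : Type*} {m : ℕ} {S : Fin (m + 1) → Type*}
    [mS : ∀ j, MeasurableSpace (S j)] (X : ∀ j, Ω → S j) (i : Fin (m + 1)) :
    MeasurableSpace Ω :=
  ⨆ j : Fin (m + 1), ⨆ _ : j ≤ i, (mS j).comap (X j)

/-!
# A Freedman-type inequality for Hermitian matrix martingales

The proof is the Laplace transform method with `E tr exp (h Zₘ)` in the role of the moment
generating function.

If `|h| cᵢ ≤ 1`, then passing from `Zᵢ₋₁` to `Zᵢ` multiplies `E tr exp (h Zᵢ)` by at most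
`1 + h² σᵢ²` (`integral_re_trace_exp_add_le`). The matrices `Zᵢ₋₁` and `Dᵢ` need not commute, so
`exp (h Zᵢ)` does not factor; the Golden–Thompson inequality `re_trace_exp_add_le` replaces its
trace by the larger `tr (exp (h Zᵢ₋₁) exp (h Dᵢ))`. As `h Dᵢ` has norm at most one,
`exp (h Dᵢ) ≤ 1 + h Dᵢ + h² Dᵢ²` in the Loewner order. Pulling `exp (h Zᵢ₋₁)` out of the conditional
expectation kills the linear term and bounds the quadratic one by `h² σᵢ² tr exp (h Zᵢ₋₁)`.
Iteration gives `E tr exp (h Zₘ) ≤ n exp (h² V)`. The norm of `Zₘ` is up to sign an eigenvalue of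
it, so `exp (h ‖Zₘ‖) ≤ tr exp (h Zₘ) + tr exp (-h Zₘ)`, and Markov's inequality with
`h = t / (2V)` yields the bound; the range of `t` is what makes `h cᵢ ≤ 1`.

The Golden–Thompson inequality is proved from the Lie product formula `tendsto_exp_mul_exp_pow`
along the exponents `2ᵏ` and the inequality `|tr (XY)^{2ᵏ}| ≤ |tr X^{2ᵏ} Y^{2ᵏ}|` for Hermitian
`X`, `Y` (`norm_trace_mul_pow_le`), which follows from repeated use of Cauchy–Schwarz.
-/

open scoped Matrix MatrixOrder ComplexOrder

/-! ### Trace inequalities for products of matrices -/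

section Trace

variable {ι : Type*} [Fintype ι]

/-- Cauchy–Schwarz for the Hilbert–Schmidt inner product. -/
lemma norm_trace_mul_sq_le (A B : Matrix ι ι ℂ) :
    ‖(A * B).trace‖ ^ 2 ≤ ‖(Aᴴ * A).trace‖ * ‖(B * Bᴴ).trace‖ := by
  have key : ∀ M : Matrix ι ι ℂ, ‖(Mᴴ * M).trace‖ = ∑ p : ι × ι, ‖M p.1 p.2‖ ^ 2 := by
    intro M
    have : (Mᴴ * M).trace = ((∑ p : ι × ι, ‖M p.1 p.2‖ ^ 2 : ℝ) : ℂ) := by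
      rw [Fintype.sum_prod_type_right, Matrix.trace]
      push_cast
      refine Finset.sum_congr rfl fun i _ ↦ ?_
      rw [Matrix.diag_apply, Matrix.mul_apply]
      exact Finset.sum_congr rfl fun j _ ↦ by
        rw [Matrix.conjTranspose_apply, RCLike.star_def, Complex.conj_mul']
    rw [this, Complex.norm_real, Real.norm_of_nonneg (by positivity)]
  have hB : ‖(B * Bᴴ).trace‖ = ∑ p : ι × ι, ‖B p.2 p.1‖ ^ 2 := by
    rw [Matrix.trace_mul_comm, key, Fintype.sum_prod_type_right, Fintype.sum_prod_type]
  have h1 : ‖(A * B).trace‖ ≤ ∑ p : ι × ι, ‖A p.1 p.2‖ * ‖B p.2 p.1‖ := by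
    rw [Fintype.sum_prod_type, Matrix.trace]
    refine (norm_sum_le _ _).trans (Finset.sum_le_sum fun i _ ↦ ?_)
    rw [Matrix.diag_apply, Matrix.mul_apply]
    refine (norm_sum_le _ _).trans (Finset.sum_le_sum fun j _ ↦ (norm_mul _ _).le)
  rw [key, hB]
  exact (pow_le_pow_left₀ (norm_nonneg _) h1 2).trans (Finset.sum_mul_sq_le_sq_mul_sq _ _ _)

variable [DecidableEq ι]

lemma trace_mul_pow_comm (A B : Matrix ι ι ℂ) (k : ℕ) :
    ((A * B) ^ k).trace = ((B * A) ^ k).trace := by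
  cases k with
  | zero => simp
  | succ k =>
    have h : (A * B) ^ k * A = A * (B * A) ^ k := by
      have : SemiconjBy A (B * A) (A * B) := by simp [SemiconjBy, mul_assoc]
      exact (this.pow_right k).eq.symm
    rw [pow_succ, ← mul_assoc, h, mul_assoc, Matrix.trace_mul_comm, mul_assoc, ← pow_succ]

/-- Hölder's inequality for the trace of the alternating word `ABAB⋯`, at dyadic exponents. In the
inductive step the inequality is applied first to the pair `AB`, `AB`, which gives
`tr ((AᴴA) (BBᴴ)) ^ 2 ^ k`, and then to the pair `AᴴA`, `BBᴴ`. -/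
lemma norm_trace_mul_pow_sq_le (k : ℕ) : ∀ A B : Matrix ι ι ℂ,
    ‖((A * B) ^ 2 ^ k).trace‖ ^ 2 ≤ ‖((Aᴴ * A) ^ 2 ^ k).trace‖ * ‖((B * Bᴴ) ^ 2 ^ k).trace‖ := by
  induction k with
  | zero => simpa using norm_trace_mul_sq_le
  | succ k ih =>
    intro A B
    have h1 := ih (A * B) (A * B)
    have h2 := ih (Aᴴ * A) (B * Bᴴ)
    have e1 : (((A * B)ᴴ * (A * B)) ^ 2 ^ k).trace = ((Aᴴ * A * (B * Bᴴ)) ^ 2 ^ k).trace := by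
      rw [Matrix.conjTranspose_mul,
        show Bᴴ * Aᴴ * (A * B) = Bᴴ * (Aᴴ * A * B) by simp only [mul_assoc], trace_mul_pow_comm]
      simp only [mul_assoc]
    have e2 : ((A * B * (A * B)ᴴ) ^ 2 ^ k).trace = ((Aᴴ * A * (B * Bᴴ)) ^ 2 ^ k).trace := by
      rw [Matrix.conjTranspose_mul,
        show A * B * (Bᴴ * Aᴴ) = A * (B * Bᴴ * Aᴴ) by simp only [mul_assoc], trace_mul_pow_comm,
        show B * Bᴴ * Aᴴ * A = B * Bᴴ * (Aᴴ * A) by simp only [mul_assoc], trace_mul_pow_comm]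
    have e3 : ∀ M : Matrix ι ι ℂ, M ^ 2 ^ (k + 1) = (M * M) ^ 2 ^ k := fun M ↦ by
      rw [pow_succ', pow_mul, sq]
    rw [e1, e2] at h1
    simp only [Matrix.conjTranspose_mul, Matrix.conjTranspose_conjTranspose] at h2
    rw [e3, e3, e3]
    nlinarith

/-- The trace of a dyadic power of a product of Hermitian matrices grows when the power is moved
inside the product. -/
lemma norm_trace_mul_pow_le (k : ℕ) : ∀ {X Y : Matrix ι ι ℂ}, X.IsHermitian → Y.IsHermitian →
    ‖((X * Y) ^ 2 ^ k).trace‖ ≤ ‖(X ^ 2 ^ k * Y ^ 2 ^ k).trace‖ := by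
  induction k with
  | zero => simp
  | succ k ih =>
    intro X Y hX hY
    have h1 := norm_trace_mul_pow_sq_le k (X * Y) (X * Y)
    have e1 : (((X * Y)ᴴ * (X * Y)) ^ 2 ^ k).trace = ((X ^ 2 * Y ^ 2) ^ 2 ^ k).trace := by
      rw [Matrix.conjTranspose_mul, hX.eq, hY.eq,
        show Y * X * (X * Y) = Y * (X * X * Y) by simp only [mul_assoc], trace_mul_pow_comm]
      simp only [mul_assoc, sq]
    have e2 : ((X * Y * (X * Y)ᴴ) ^ 2 ^ k).trace = ((X ^ 2 * Y ^ 2) ^ 2 ^ k).trace := by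
      rw [Matrix.conjTranspose_mul, hX.eq, hY.eq,
        show X * Y * (Y * X) = X * (Y * Y * X) by simp only [mul_assoc], trace_mul_pow_comm,
        show Y * Y * X * X = Y * Y * (X * X) by simp only [mul_assoc], trace_mul_pow_comm]
      simp only [sq]
    have e3 : ∀ M : Matrix ι ι ℂ, M ^ 2 ^ (k + 1) = (M ^ 2) ^ 2 ^ k := fun M ↦ by
      rw [pow_succ', pow_mul]
    rw [e1, e2, ← sq, ← sq] at h1
    rw [e3, e3, e3]
    exact ((pow_le_pow_iff_left₀ (norm_nonneg _) (norm_nonneg _) two_ne_zero).1 h1).trans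
      (ih (hX.pow 2) (hY.pow 2))

lemma trace_mul_nonneg {P Q : Matrix ι ι ℂ} (hP : 0 ≤ P) (hQ : 0 ≤ Q) : 0 ≤ (P * Q).trace := by
  obtain ⟨S, rfl⟩ := CStarAlgebra.nonneg_iff_eq_star_mul_self.1 hP
  rw [mul_assoc, Matrix.trace_mul_comm]
  exact ((Matrix.nonneg_iff_posSemidef.1 hQ).mul_mul_conjTranspose_same S).trace_nonneg

lemma re_trace_mul_le_re_trace_mul {P Q R : Matrix ι ι ℂ} (hP : 0 ≤ P) (hQR : Q ≤ R) :
    (P * Q).trace.re ≤ (P * R).trace.re := by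
  have := (Complex.nonneg_iff.1 (trace_mul_nonneg hP (sub_nonneg.2 hQR))).1
  rw [mul_sub, Matrix.trace_sub, Complex.sub_re] at this
  linarith

/-- The Hermitian part of `G` has the same trace against `P` and a norm that is not larger, so `G`
need not be Hermitian. -/
lemma re_trace_mul_le_norm_mul {P : Matrix ι ι ℂ} (hP : 0 ≤ P) (G : Matrix ι ι ℂ) :
    (P * G).trace.re ≤ ‖G‖ * P.trace.re := by
  have hPh : Pᴴ = P := (Matrix.nonneg_iff_posSemidef.1 hP).isHermitian
  have e1 : (P * Gᴴ).trace.re = (P * G).trace.re := by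
    have : (P * Gᴴ).trace = star (P * G).trace := by
      rw [← Matrix.trace_conjTranspose, Matrix.conjTranspose_mul, hPh, Matrix.trace_mul_comm]
    simp [this]
  have hG : IsSelfAdjoint (G + Gᴴ) := IsSelfAdjoint.add_star_self G
  have h1 := re_trace_mul_le_re_trace_mul hP hG.le_algebraMap_norm_self
  have h2 : ‖G + Gᴴ‖ ≤ 2 * ‖G‖ := by
    refine (norm_add_le _ _).trans ?_
    rw [← Matrix.star_eq_conjTranspose, norm_star, two_mul]
  have h3 : 0 ≤ P.trace.re :=
    (Complex.nonneg_iff.1 (Matrix.nonneg_iff_posSemidef.1 hP).trace_nonneg).1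
  rw [Algebra.algebraMap_eq_smul_one, mul_smul_comm, mul_one, Matrix.trace_smul, Complex.smul_re,
    mul_add, Matrix.trace_add, Complex.add_re, e1, smul_eq_mul] at h1
  nlinarith

end Trace

/-! ### The Lie product formula and the Golden–Thompson inequality -/

section GoldenThompson

open Filter Topology NormedSpace

lemma norm_exp_le_exp_norm {𝔸 : Type*} [NormedRing 𝔸] [NormOneClass 𝔸] [NormedAlgebra ℝ 𝔸]
    [CompleteSpace 𝔸] (x : 𝔸) : ‖exp x‖ ≤ Real.exp ‖x‖ := by
  have h1 : HasSum (fun n : ℕ ↦ ((n.factorial : ℝ)⁻¹) • ‖x‖ ^ n) (Real.exp ‖x‖) := by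
    rw [Real.exp_eq_exp_ℝ]
    exact exp_series_hasSum_exp' (𝕂 := ℝ) ‖x‖
  rw [exp_eq_tsum ℝ]
  refine tsum_of_norm_bounded h1 fun n ↦ ?_
  rw [norm_smul, norm_inv, Real.norm_natCast, smul_eq_mul]
  gcongr
  exact norm_pow_le x n

lemma norm_pow_sub_pow_le {𝔸 : Type*} [NormedRing 𝔸] [NormOneClass 𝔸] {x y : 𝔸} {M : ℝ}
    (hM : 1 ≤ M) (hx : ‖x‖ ≤ M) (hy : ‖y‖ ≤ M) (n : ℕ) :
    ‖x ^ n - y ^ n‖ ≤ n * M ^ n * ‖x - y‖ := by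
  induction n with
  | zero => simp
  | succ n ih =>
    have hxn : ‖x ^ n‖ ≤ M ^ n := (norm_pow_le _ _).trans (by gcongr)
    have e : x ^ (n + 1) - y ^ (n + 1) = x ^ n * (x - y) + (x ^ n - y ^ n) * y := by
      rw [pow_succ, pow_succ]; noncomm_ring
    calc ‖x ^ (n + 1) - y ^ (n + 1)‖ ≤ ‖x ^ n‖ * ‖x - y‖ + ‖x ^ n - y ^ n‖ * ‖y‖ := by
          rw [e]
          exact (norm_add_le _ _).trans (add_le_add (norm_mul_le _ _) (norm_mul_le _ _))
      _ ≤ M ^ n * ‖x - y‖ + n * M ^ n * ‖x - y‖ * M := by gcongr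
      _ ≤ M ^ n * M * ‖x - y‖ + n * M ^ n * ‖x - y‖ * M := by
          gcongr
          exact le_mul_of_one_le_right (by positivity) hM
      _ = (n + 1 : ℕ) * M ^ (n + 1) * ‖x - y‖ := by push_cast; ring

/-- **Lie product formula**. -/
lemma tendsto_exp_mul_exp_pow {𝔸 : Type*} [NormedRing 𝔸] [NormOneClass 𝔸] [NormedAlgebra ℝ 𝔸]
    [CompleteSpace 𝔸] (x y : 𝔸) :
    Tendsto (fun n : ℕ ↦ (exp ((n : ℝ)⁻¹ • x) * exp ((n : ℝ)⁻¹ • y)) ^ n) atTop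
      (𝓝 (exp (x + y))) := by
  -- `exp (u x) exp (u y)` and `exp (u (x + y))` agree to first order at `u = 0`.
  have hd : HasDerivAt
      (fun u : ℝ ↦ exp (u • x) * exp (u • y) - exp (u • (x + y))) 0 0 := by
    have := ((hasDerivAt_exp_smul_const x (0 : ℝ)).mul (hasDerivAt_exp_smul_const y (0 : ℝ))).sub
      (hasDerivAt_exp_smul_const (x + y) (0 : ℝ))
    simp only [zero_smul, exp_zero, one_mul, mul_one, sub_self] at this
    exact this
  have hinv : Tendsto (fun n : ℕ ↦ (n : ℝ)⁻¹) atTop (𝓝[≠] 0) := by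
    refine tendsto_nhdsWithin_iff.2 ⟨tendsto_inv_atTop_nhds_zero_nat, ?_⟩
    filter_upwards [eventually_gt_atTop 0] with n hn
    simpa using hn.ne'
  have hlim := ((hasDerivAt_iff_tendsto_slope.1 hd).comp hinv).norm
  rw [norm_zero] at hlim
  have hlim' := hlim.mul_const (Real.exp (‖x‖ + ‖y‖))
  rw [zero_mul] at hlim'
  rw [tendsto_iff_norm_sub_tendsto_zero]
  refine squeeze_zero' (Eventually.of_forall fun _ ↦ norm_nonneg _) ?_ hlim'
  filter_upwards [eventually_gt_atTop 0] with n hn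
  have hn' : (n : ℝ) ≠ 0 := by simpa using hn.ne'
  set M := Real.exp ((n : ℝ)⁻¹ * (‖x‖ + ‖y‖)) with hMdef
  have hM : 1 ≤ M := Real.one_le_exp (by positivity)
  have hMn : M ^ n = Real.exp (‖x‖ + ‖y‖) := by
    rw [hMdef, ← Real.exp_nat_mul]; congr 1; field_simp
  have hsm : ∀ z : 𝔸, ‖(n : ℝ)⁻¹ • z‖ = (n : ℝ)⁻¹ * ‖z‖ := fun z ↦ by
    rw [norm_smul, norm_inv, Real.norm_natCast]
  have h1 : ‖exp ((n : ℝ)⁻¹ • x) * exp ((n : ℝ)⁻¹ • y)‖ ≤ M := by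
    refine (norm_mul_le _ _).trans ?_
    rw [hMdef, mul_add, Real.exp_add, ← hsm, ← hsm]
    gcongr <;> exact norm_exp_le_exp_norm _
  have h2 : ‖exp ((n : ℝ)⁻¹ • (x + y))‖ ≤ M := by
    refine (norm_exp_le_exp_norm _).trans (Real.exp_le_exp.2 ?_)
    rw [hsm]
    gcongr
    exact norm_add_le _ _
  have e : exp (x + y) = exp ((n : ℝ)⁻¹ • (x + y)) ^ n := by
    let _ : NormedAlgebra ℚ 𝔸 := NormedAlgebra.restrictScalars ℚ ℝ 𝔸
    rw [← exp_nsmul, ← Nat.cast_smul_eq_nsmul ℝ, smul_smul, mul_inv_cancel₀ hn', one_smul]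
  rw [e]
  refine (norm_pow_sub_pow_le hM h1 h2 n).trans (le_of_eq ?_)
  rw [hMn, Function.comp_apply, slope_def_module, norm_smul]
  simp
  ring

variable {ι : Type*} [Fintype ι] [DecidableEq ι]

/-- **Golden–Thompson inequality**. -/
lemma re_trace_exp_add_le {A B : Matrix ι ι ℂ} (hA : A.IsHermitian) (hB : B.IsHermitian) :
    (exp (A + B)).trace.re ≤ (exp A * exp B).trace.re := by
  rcases isEmpty_or_nonempty ι with hι | hι
  · simp [Matrix.trace]
  have hpos : 0 ≤ (exp A * exp B).trace :=
    trace_mul_nonneg (IsSelfAdjoint.exp_nonneg hA) (IsSelfAdjoint.exp_nonneg hB)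
  have hre : (exp A * exp B).trace.re = ‖(exp A * exp B).trace‖ := by
    rw [← Complex.norm_of_nonneg' hpos, Complex.ofReal_re]
    simp
  rw [hre]
  refine (Complex.re_le_norm _).trans ?_
  have hlim := ((tendsto_exp_mul_exp_pow A B).comp
    (tendsto_pow_atTop_atTop_of_one_lt (one_lt_two (α := ℕ))))
  have hcont : Continuous fun M : Matrix ι ι ℂ ↦ ‖M.trace‖ := by fun_prop
  refine le_of_tendsto ((hcont.tendsto _).comp hlim) (Eventually.of_forall fun k ↦ ?_)
  have hs : ∀ {C : Matrix ι ι ℂ}, C.IsHermitian →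
      (exp (((2 ^ k : ℕ) : ℝ)⁻¹ • C)).IsHermitian := fun hC ↦
    (IsSelfAdjoint.smul (IsSelfAdjoint.all _) hC).exp
  have hp : ∀ C : Matrix ι ι ℂ, exp (((2 ^ k : ℕ) : ℝ)⁻¹ • C) ^ 2 ^ k = exp C := fun C ↦ by
    rw [← Matrix.exp_nsmul, ← Nat.cast_smul_eq_nsmul ℝ, smul_smul, mul_inv_cancel₀ (by simp),
      one_smul]
  have := norm_trace_mul_pow_le k (hs hA) (hs hB)
  rwa [hp, hp] at this

end GoldenThompson

/-! ### Bounds on the exponential of a Hermitian matrix -/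

section ExpBounds

open NormedSpace

variable {ι : Type*} [Fintype ι] [DecidableEq ι]

/-- The operator form of `eˣ ≤ 1 + x + x²` for `|x| ≤ 1`. -/
lemma exp_le_one_add_add_sq {D : Matrix ι ι ℂ} (hD : D.IsHermitian) (h1 : ‖D‖ ≤ 1) :
    exp D ≤ 1 + D + D ^ 2 := by
  have hD' : IsSelfAdjoint D := hD
  have e : cfc (fun x : ℝ ↦ 1 + x + x ^ 2) D = 1 + D + D ^ 2 := by
    rw [cfc_add D (fun x : ℝ ↦ 1 + x) (fun x ↦ x ^ 2), cfc_add D (fun _ : ℝ ↦ 1) (fun x ↦ x),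
      cfc_pow (fun x : ℝ ↦ x) 2 D, cfc_id' ℝ D, cfc_const_one ℝ D]
  rw [← CFC.real_exp_eq_normedSpace_exp hD', ← e]
  refine cfc_mono fun x hx ↦ ?_
  rcases isEmpty_or_nonempty ι with hι | hι
  · exact absurd hx (by simp [spectrum.of_subsingleton])
  have hx1 : |x| ≤ 1 := (spectrum.norm_le_norm_of_mem hx).trans h1
  have := (abs_le.1 (Real.abs_exp_sub_one_sub_id_le hx1)).2
  linarith

lemma exp_le_re_trace_exp {A : Matrix ι ι ℂ} (hA : A.IsHermitian) {x : ℝ}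
    (hx : x ∈ spectrum ℝ A) : Real.exp x ≤ (exp A).trace.re := by
  have hA' : IsSelfAdjoint A := hA
  have hE : (exp A).PosSemidef := Matrix.nonneg_iff_posSemidef.1 hA'.exp_nonneg
  have hm : Real.exp x ∈ spectrum ℝ (exp A) := by
    rw [← CFC.real_exp_eq_normedSpace_exp hA', cfc_map_spectrum Real.exp A]
    exact ⟨x, hx, rfl⟩
  rw [hE.isHermitian.spectrum_real_eq_range_eigenvalues] at hm
  obtain ⟨i, hi⟩ := hm
  rw [hE.isHermitian.trace_eq_sum_eigenvalues, Complex.re_sum, ← hi]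
  simpa using Finset.single_le_sum (fun j _ ↦ hE.eigenvalues_nonneg j) (Finset.mem_univ i)

lemma re_trace_exp_nonneg {A : Matrix ι ι ℂ} (hA : A.IsHermitian) : 0 ≤ (exp A).trace.re :=
  (Complex.nonneg_iff.1
    (Matrix.nonneg_iff_posSemidef.1 (IsSelfAdjoint.exp_nonneg hA)).trace_nonneg).1

/-- The norm of a Hermitian matrix is up to sign an eigenvalue of it. -/
lemma exp_mul_norm_le {A : Matrix ι ι ℂ} (hA : A.IsHermitian) {h : ℝ} [Nonempty ι] :
    Real.exp (h * ‖A‖) ≤ (exp (h • A)).trace.re + (exp (-h • A)).trace.re := by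
  have hs : ∀ r : ℝ, (r • A).IsHermitian := fun r ↦ IsSelfAdjoint.smul (IsSelfAdjoint.all r) hA
  have h1 := re_trace_exp_nonneg (hs h)
  have h2 := re_trace_exp_nonneg (hs (-h))
  have key : ∀ r x : ℝ, x ∈ spectrum ℝ A → r * x ∈ spectrum ℝ (r • A) := by
    intro r x hx
    have hA' : IsSelfAdjoint A := hA
    have e : cfc (fun y : ℝ ↦ r * y) A = r • A := by
      rw [cfc_const_mul r (fun y ↦ y) A, cfc_id' ℝ A]
    rw [← e, cfc_map_spectrum (fun y : ℝ ↦ r * y) A]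
    exact ⟨x, hx, rfl⟩
  rcases CStarAlgebra.norm_or_neg_norm_mem_spectrum (a := A) hA with hx | hx
  · linarith [exp_le_re_trace_exp (hs _) (key h _ hx)]
  · have := exp_le_re_trace_exp (hs _) (key (-h) _ hx)
    rw [neg_mul_neg] at this
    linarith

end ExpBounds

/-! ### The exponential supermartingale -/

section Martingale

open NormedSpace

variable {ι : Type*} [Fintype ι] [DecidableEq ι]

lemma integrable_linearMap_mul {𝔸 Ω : Type*} [NormedRing 𝔸] [NormedAlgebra ℝ 𝔸]
    [MeasurableSpace Ω] {P : Measure Ω} {φ : 𝔸 →ₗ[ℝ] ℝ} (hφ : Continuous φ)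
    {W G : Ω → 𝔸} (hW : AEStronglyMeasurable W P) {K : ℝ} (hK : ∀ᵐ ω ∂P, ‖W ω‖ ≤ K)
    (hG : Integrable G P) : Integrable (fun ω ↦ φ (W ω * G ω)) P :=
  ContinuousLinearMap.integrable_comp ⟨φ, hφ⟩
    ((ContinuousLinearMap.mul ℝ 𝔸).integrable_of_bilin_of_bdd_left K hW hK hG)

/-- Pull-out property of the conditional expectation under a linear functional `φ` of a product in
a possibly noncommutative algebra. -/
lemma integral_linearMap_mul_condExp {𝔸 Ω : Type*} [NormedRing 𝔸] [NormedAlgebra ℝ 𝔸]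
    [CompleteSpace 𝔸] {m mΩ : MeasurableSpace Ω} (hm : m ≤ mΩ) {P : Measure Ω} [IsFiniteMeasure P]
    {φ : 𝔸 →ₗ[ℝ] ℝ} (hφ : Continuous φ)
    {W G : Ω → 𝔸} (hW : AEStronglyMeasurable[m] W P) {K : ℝ} (hK : ∀ᵐ ω ∂P, ‖W ω‖ ≤ K)
    (hG : Integrable G P) :
    ∫ ω, φ (W ω * G ω) ∂P = ∫ ω, φ (W ω * (P[G | m]) ω) ∂P := by
  let B : 𝔸 →L[ℝ] 𝔸 →L[ℝ] ℝ :=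
    (ContinuousLinearMap.compL ℝ 𝔸 𝔸 ℝ ⟨φ, hφ⟩).comp (ContinuousLinearMap.mul ℝ 𝔸)
  have h := integral_congr_ae (condExp_aestronglyMeasurable_bilin_of_bound B hm hW hG K hK)
  rw [integral_condExp hm] at h
  exact h

lemma continuous_matrix_exp_smul (h : ℝ) :
    Continuous fun A : Matrix ι ι ℂ ↦ exp (h • A) := by
  let _ : NormedAlgebra ℚ (Matrix ι ι ℂ) := NormedAlgebra.restrictScalars ℚ ℝ _
  exact exp_continuous.comp (continuous_const_smul h)

/-- A continuous function of an essentially bounded random matrix is essentially bounded. -/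
lemma exists_ae_norm_comp_le {Ω : Type*} [MeasurableSpace Ω] {P : Measure Ω}
    {Y : Ω → Matrix ι ι ℂ} {C : ℝ} (hY : ∀ᵐ ω ∂P, ‖Y ω‖ ≤ C)
    {E : Type*} [NormedAddCommGroup E] {f : Matrix ι ι ℂ → E} (hf : Continuous f) :
    ∃ K, ∀ᵐ ω ∂P, ‖f (Y ω)‖ ≤ K := by
  have : ProperSpace (Matrix ι ι ℂ) := FiniteDimensional.proper ℂ _
  obtain ⟨K, hK⟩ := (isCompact_closedBall (0 : Matrix ι ι ℂ) C).exists_bound_of_continuousOn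
    hf.continuousOn
  exact ⟨K, hY.mono fun ω hω ↦ hK _ (by simpa using hω)⟩

lemma integrable_re_trace_exp_smul {Ω : Type*} [MeasurableSpace Ω] {P : Measure Ω}
    [IsProbabilityMeasure P] {Y : Ω → Matrix ι ι ℂ} (hYm : AEStronglyMeasurable Y P) {C : ℝ}
    (hY : ∀ᵐ ω ∂P, ‖Y ω‖ ≤ C) (h : ℝ) :
    Integrable (fun ω ↦ (exp (h • Y ω)).trace.re) P := by
  have hc : Continuous fun A : Matrix ι ι ℂ ↦ (exp (h • A)).trace.re :=
    Complex.continuous_re.comp (continuous_matrix_exp_smul h).matrix_trace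
  obtain ⟨K, hK⟩ := exists_ae_norm_comp_le hY hc
  exact Integrable.of_bound (hc.comp_aestronglyMeasurable hYm) K hK

/-- One step of the martingale. Golden–Thompson separates the increment `D` from the past `Y`; the
second-order bound on `exp (h D)` then leaves only the first two conditional moments of `D`. -/
lemma integral_re_trace_exp_add_le {Ω : Type*} {m mΩ : MeasurableSpace Ω} (hm : m ≤ mΩ)
    {P : Measure Ω} [IsProbabilityMeasure P] {Y D : Ω → Matrix ι ι ℂ}
    (hYm : AEStronglyMeasurable[m] Y P) (hYh : ∀ᵐ ω ∂P, (Y ω).IsHermitian) {C : ℝ}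
    (hYC : ∀ᵐ ω ∂P, ‖Y ω‖ ≤ C)
    (hDm : AEStronglyMeasurable D P) (hDh : ∀ᵐ ω ∂P, (D ω).IsHermitian) {c s h : ℝ}
    (hDc : ∀ᵐ ω ∂P, ‖D ω‖ ≤ c) (hD0 : P[D | m] =ᵐ[P] 0)
    (hD2 : ∀ᵐ ω ∂P, ‖(P[fun ω' ↦ D ω' ^ 2 | m]) ω‖ ≤ s) (hh : |h| * c ≤ 1) :
    ∫ ω, (exp (h • (Y ω + D ω))).trace.re ∂P ≤
      (1 + h ^ 2 * s) * ∫ ω, (exp (h • Y ω)).trace.re ∂P := by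
  have hsa : ∀ {A : Matrix ι ι ℂ} (r : ℝ), A.IsHermitian → (r • A).IsHermitian :=
    fun r hA ↦ IsSelfAdjoint.smul (IsSelfAdjoint.all r) hA
  let W : Ω → Matrix ι ι ℂ := fun ω ↦ exp (h • Y ω)
  have hWm : AEStronglyMeasurable[m] W P :=
    (continuous_matrix_exp_smul h).comp_aestronglyMeasurable hYm
  obtain ⟨K, hK⟩ : ∃ K, ∀ᵐ ω ∂P, ‖W ω‖ ≤ K :=
    exists_ae_norm_comp_le hYC (continuous_matrix_exp_smul h)
  have hDint : Integrable D P := Integrable.of_bound hDm c hDc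
  have hD2int : Integrable (fun ω ↦ D ω ^ 2) P := by
    obtain ⟨K', hK'⟩ := exists_ae_norm_comp_le hDc (continuous_pow 2)
    exact Integrable.of_bound ((continuous_pow 2).comp_aestronglyMeasurable hDm) K' hK'
  let φ : Matrix ι ι ℂ →ₗ[ℝ] ℝ := Complex.reLm ∘ₗ Matrix.traceLinearMap ι ℝ ℂ
  have hφ : Continuous φ := φ.continuous_of_finiteDimensional
  have hBint : ∀ {G : Ω → Matrix ι ι ℂ}, Integrable G P →
      Integrable (fun ω ↦ (W ω * G ω).trace.re) P := fun hG ↦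
    integrable_linearMap_mul hφ (hWm.mono hm) hK hG
  have hpull : ∀ {G : Ω → Matrix ι ι ℂ}, Integrable G P →
      ∫ ω, (W ω * G ω).trace.re ∂P = ∫ ω, (W ω * (P[G | m]) ω).trace.re ∂P := fun hG ↦
    integral_linearMap_mul_condExp hm hφ hWm hK hG
  have hWint : Integrable (fun ω ↦ (W ω).trace.re) P :=
    integrable_re_trace_exp_smul (hYm.mono hm) hYC h
  have hlin : ∫ ω, (W ω * D ω).trace.re ∂P = 0 := by
    rw [hpull hDint]
    refine integral_eq_zero_of_ae ?_
    filter_upwards [hD0] with ω hω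
    simp [hω]
  have hquad : ∫ ω, (W ω * D ω ^ 2).trace.re ∂P ≤ s * ∫ ω, (W ω).trace.re ∂P := by
    rw [hpull hD2int, ← integral_const_mul]
    refine integral_mono_ae (hBint integrable_condExp) (hWint.const_mul s) ?_
    filter_upwards [hD2, hYh] with ω hω hYω
    have hW : 0 ≤ W ω := IsSelfAdjoint.exp_nonneg (hsa h hYω)
    exact (re_trace_mul_le_norm_mul hW _).trans
      (mul_le_mul_of_nonneg_right hω (re_trace_exp_nonneg (hsa h hYω)))
  have hLint : Integrable (fun ω ↦ (exp (h • (Y ω + D ω))).trace.re) P := by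
    have hYD : AEStronglyMeasurable (fun ω ↦ Y ω + D ω) P := (hYm.mono hm).add hDm
    refine integrable_re_trace_exp_smul hYD (C := C + c) ?_ h
    filter_upwards [hYC, hDc] with ω h1 h2
    exact (norm_add_le _ _).trans (add_le_add h1 h2)
  have hWD : Integrable (fun ω ↦ (W ω).trace.re + h * (W ω * D ω).trace.re) P :=
    hWint.add ((hBint hDint).const_mul h)
  have hRint : Integrable (fun ω ↦ (W ω).trace.re + h * (W ω * D ω).trace.re
      + h ^ 2 * (W ω * D ω ^ 2).trace.re) P :=
    hWD.add ((hBint hD2int).const_mul (h ^ 2))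
  calc ∫ ω, (exp (h • (Y ω + D ω))).trace.re ∂P
      ≤ ∫ ω, ((W ω).trace.re + h * (W ω * D ω).trace.re
          + h ^ 2 * (W ω * D ω ^ 2).trace.re) ∂P := by
        refine integral_mono_ae hLint hRint ?_
        · filter_upwards [hYh, hDh, hDc] with ω h1 h2 h3
          have h4 : ‖h • D ω‖ ≤ 1 := by
            rw [norm_smul, Real.norm_eq_abs]
            exact (mul_le_mul_of_nonneg_left h3 (abs_nonneg h)).trans hh
          have h5 := re_trace_mul_le_re_trace_mul (IsSelfAdjoint.exp_nonneg (hsa h h1))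
            (exp_le_one_add_add_sq (hsa h h2) h4)
          have h6 := re_trace_exp_add_le (hsa h h1) (hsa h h2)
          rw [← smul_add] at h6
          refine (h6.trans h5).trans (le_of_eq ?_)
          simp only [W, smul_pow, mul_add, mul_one, mul_smul_comm,
            Matrix.trace_add, Matrix.trace_smul, Complex.add_re, Complex.smul_re, smul_eq_mul]
    _ = ∫ ω, (W ω).trace.re ∂P + h ^ 2 * ∫ ω, (W ω * D ω ^ 2).trace.re ∂P := by
        rw [integral_add hWD ((hBint hD2int).const_mul _),
          integral_add hWint ((hBint hDint).const_mul h), integral_const_mul, integral_const_mul,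
          hlin, mul_zero, add_zero]
    _ ≤ (1 + h ^ 2 * s) * ∫ ω, (W ω).trace.re ∂P := by
        have := mul_le_mul_of_nonneg_left hquad (sq_nonneg h)
        linarith

lemma sigmaPast_le {Ω : Type*} [mΩ : MeasurableSpace Ω] {m : ℕ} {S : Fin (m + 1) → Type*}
    [∀ j, MeasurableSpace (S j)] {X : ∀ j, Ω → S j} (hX : ∀ j, Measurable (X j))
    (i : Fin (m + 1)) : sigmaPast X i ≤ mΩ :=
  iSup₂_le fun j _ ↦ (hX j).comap_le

variable {Ω : Type*} [MeasurableSpace Ω] {P : Measure Ω}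
  {m : ℕ} {Z : Fin (m + 1) → Ω → Matrix ι ι ℂ} {c : Fin m → ℝ}

lemma ae_norm_le_sum_of_diff (hZ0 : ∀ᵐ ω ∂P, Z 0 ω = 0)
    (hc : ∀ i : Fin m, ∀ᵐ ω ∂P, ‖Z i.succ ω - Z i.castSucc ω‖ ≤ c i) (k : Fin (m + 1)) :
    ∃ C, ∀ᵐ ω ∂P, ‖Z k ω‖ ≤ C := by
  induction k using Fin.induction with
  | zero => exact ⟨0, hZ0.mono fun ω hω ↦ by simp [hω]⟩
  | succ i ih =>
    obtain ⟨C, hC⟩ := ih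
    refine ⟨C + c i, ?_⟩
    filter_upwards [hC, hc i] with ω h1 h2
    calc ‖Z i.succ ω‖ = ‖Z i.castSucc ω + (Z i.succ ω - Z i.castSucc ω)‖ := by
          rw [add_sub_cancel]
      _ ≤ C + c i := (norm_add_le _ _).trans (add_le_add h1 h2)

/-- The matrix moment generating function of the martingale, obtained by iterating the one-step bound
from `tr exp 0 = card ι`. -/
lemma integral_re_trace_exp_smul_le [IsProbabilityMeasure P]
    {S : Fin (m + 1) → Type*} [∀ j, MeasurableSpace (S j)]
    {X : ∀ j, Ω → S j} (hX : ∀ j, Measurable (X j))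
    (hZmeas : ∀ i, AEStronglyMeasurable (Z i) P)
    (hZherm : ∀ i, ∀ᵐ ω ∂P, (Z i ω).IsHermitian) (hZ0 : ∀ᵐ ω ∂P, Z 0 ω = 0)
    (hmart : ∀ i : Fin m, P[Z i.succ | sigmaPast X i.castSucc] =ᵐ[P] Z i.castSucc)
    {σ : Fin m → ℝ}
    (hc : ∀ i : Fin m, ∀ᵐ ω ∂P, ‖Z i.succ ω - Z i.castSucc ω‖ ≤ c i)
    (hσ : ∀ i : Fin m, ∀ᵐ ω ∂P,
      ‖(P[fun ω' ↦ (Z i.succ ω' - Z i.castSucc ω') ^ 2 | sigmaPast X i.castSucc]) ω‖ ≤ σ i ^ 2)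
    {h : ℝ} (hh : ∀ i, |h| * c i ≤ 1) :
    ∫ ω, (exp (h • Z (Fin.last m) ω)).trace.re ∂P ≤
      Fintype.card ι * Real.exp (h ^ 2 * ∑ i, σ i ^ 2) := by
  have hZint : ∀ k, Integrable (Z k) P := fun k ↦ by
    obtain ⟨C, hC⟩ := ae_norm_le_sum_of_diff hZ0 hc k
    exact Integrable.of_bound (hZmeas k) C hC
  suffices H : ∀ k : Fin (m + 1), ∫ ω, (exp (h • Z k ω)).trace.re ∂P ≤
      Fintype.card ι * Real.exp (h ^ 2 * ∑ i with i.castSucc < k, σ i ^ 2) by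
    simpa [Fin.castSucc_lt_last] using H (Fin.last m)
  intro k
  induction k using Fin.induction with
  | zero =>
    have : ∫ ω, (exp (h • Z 0 ω)).trace.re ∂P = ∫ _, (Fintype.card ι : ℝ) ∂P :=
      integral_congr_ae <| hZ0.mono fun ω hω ↦ by simp [hω, Matrix.trace_one]
    simp [this]
  | succ i ih =>
    have hm := sigmaPast_le hX i.castSucc
    -- The martingale condition itself makes `Z i` measurable with respect to the past.
    have hYm : AEStronglyMeasurable[sigmaPast X i.castSucc] (Z i.castSucc) P :=
      stronglyMeasurable_condExp.aestronglyMeasurable.congr (hmart i)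
    obtain ⟨C, hC⟩ := ae_norm_le_sum_of_diff hZ0 hc i.castSucc
    have hD0 : P[fun ω ↦ Z i.succ ω - Z i.castSucc ω | sigmaPast X i.castSucc] =ᵐ[P] 0 := by
      refine (condExp_sub (hZint i.succ) (hZint i.castSucc) _).trans ?_
      filter_upwards [hmart i, condExp_of_aestronglyMeasurable' hm hYm (hZint _)] with ω h1 h2
      simp [h1, h2]
    have hDh : ∀ᵐ ω ∂P, (Z i.succ ω - Z i.castSucc ω).IsHermitian := by
      filter_upwards [hZherm i.succ, hZherm i.castSucc] with ω h1 h2 using h1.sub h2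
    have hstep := integral_re_trace_exp_add_le hm hYm (hZherm _) hC
      ((hZmeas i.succ).sub (hZmeas i.castSucc)) hDh (hc i) hD0 (hσ i) (hh i)
    have hset : (Finset.univ.filter fun j : Fin m ↦ j.castSucc < i.succ) =
        insert i (Finset.univ.filter fun j : Fin m ↦ j.castSucc < i.castSucc) := by
      ext j
      simp [Fin.castSucc_lt_succ_iff, le_iff_eq_or_lt]
    rw [hset, Finset.sum_insert (by simp), mul_add, Real.exp_add]
    simp only [Pi.sub_apply, add_sub_cancel] at hstep
    calc _ ≤ _ := hstep
      _ ≤ Real.exp (h ^ 2 * σ i ^ 2) * (Fintype.card ι *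
          Real.exp (h ^ 2 * ∑ j with j.castSucc < i.castSucc, σ j ^ 2)) := by
        refine mul_le_mul ?_ ih ?_ (Real.exp_pos _).le
        · rw [add_comm]; exact Real.add_one_le_exp _
        · exact integral_nonneg_of_ae <| (hZherm _).mono fun ω hω ↦
            re_trace_exp_nonneg (IsSelfAdjoint.smul (IsSelfAdjoint.all h) hω)
      _ = _ := by ring

end Martingale

/-! ### The tail bound -/

theorem theorem5 {Ω : Type*} [mΩ : MeasurableSpace Ω] (P : Measure Ω) [IsProbabilityMeasure P]
    (n m : ℕ)
    -- arbitrary random variables `X 0, …, X m`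
    {S : Fin (m + 1) → Type*} [∀ j, MeasurableSpace (S j)]
    (X : ∀ j, Ω → S j) (hX : ∀ j, Measurable (X j))
    -- Hermitian-matrix-valued random variables `Z 0 = 0, Z 1, …, Z m`
    (Z : Fin (m + 1) → Ω → Matrix (Fin n) (Fin n) ℂ)
    (hZmeas : ∀ i, AEStronglyMeasurable (Z i) P)
    (hZherm : ∀ i, ∀ᵐ ω ∂P, (Z i ω).IsHermitian)
    (hZ0 : ∀ᵐ ω ∂P, Z 0 ω = 0)
    -- the martingale condition
    (hmart : ∀ i : Fin m, P[Z i.succ | sigmaPast X i.castSucc] =ᵐ[P] Z i.castSucc)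
    -- bounds on the differences (`‖·‖` is the operator norm)
    (c σ : Fin m → ℝ)
    (hc : ∀ i : Fin m, ∀ᵐ ω ∂P, ‖Z i.succ ω - Z i.castSucc ω‖ ≤ c i)
    (hσ : ∀ i : Fin m, ∀ᵐ ω ∂P,
      ‖(P[fun ω' => (Z i.succ ω' - Z i.castSucc ω') ^ 2 | sigmaPast X i.castSucc]) ω‖ ≤ σ i ^ 2)
    (V : ℝ) (hV : V = ∑ i, σ i ^ 2)
    -- `0 ≤ t ≤ 2 V / max_i (c i)`, written without division
    (t : ℝ) (ht0 : 0 ≤ t) (ht : ∀ i, t * c i ≤ 2 * V) :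
    P.real {ω | t < ‖Z (Fin.last m) ω‖} ≤ 2 * n * Real.exp (-t ^ 2 / (4 * V)) := by
  rcases Nat.eq_zero_or_pos n with rfl | hn
  · have : {ω | t < ‖Z (Fin.last m) ω‖} = ∅ := by
      ext ω
      simp [Subsingleton.elim (Z (Fin.last m) ω) 0, ht0]
    simp [this]
  have hn1 : (1 : ℝ) ≤ n := by exact_mod_cast hn
  have : Nonempty (Fin n) := ⟨⟨0, hn⟩⟩
  have hV0 : 0 ≤ V := hV ▸ Finset.sum_nonneg fun i _ ↦ sq_nonneg _
  rcases hV0.eq_or_lt with hV' | hVpos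
  · -- For `V = 0` the exponent is a division by zero, so the bound is `2 * n ≥ 1`.
    rw [← hV']
    simp only [mul_zero, div_zero, Real.exp_zero, mul_one]
    exact measureReal_le_one.trans (by linarith)
  -- This value of `h` minimizes `h ^ 2 * V - h * t`.
  set h : ℝ := t / (2 * V) with hdef
  have hh0 : 0 ≤ h := by positivity
  have hhc : ∀ i, h * c i ≤ 1 := fun i ↦ by
    rw [hdef, div_mul_eq_mul_div, div_le_one (by positivity)]
    exact ht i
  have hplus := integral_re_trace_exp_smul_le hX hZmeas hZherm hZ0 hmart hc hσ (h := h)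
    (by rwa [abs_of_nonneg hh0])
  have hminus := integral_re_trace_exp_smul_le hX hZmeas hZherm hZ0 hmart hc hσ (h := -h)
    (by rwa [abs_neg, abs_of_nonneg hh0])
  rw [← hV, Fintype.card_fin] at hplus hminus
  rw [neg_sq] at hminus
  obtain ⟨C, hC⟩ := ae_norm_le_sum_of_diff hZ0 hc (Fin.last m)
  have hi1 := integrable_re_trace_exp_smul (hZmeas (Fin.last m)) hC h
  have hi2 := integrable_re_trace_exp_smul (hZmeas (Fin.last m)) hC (-h)
  let f : Ω → ℝ := fun ω ↦ (NormedSpace.exp (h • Z (Fin.last m) ω)).trace.re +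
    (NormedSpace.exp (-h • Z (Fin.last m) ω)).trace.re
  have hf : ∀ᵐ ω ∂P, Real.exp (h * ‖Z (Fin.last m) ω‖) ≤ f ω :=
    (hZherm _).mono fun ω hω ↦ exp_mul_norm_le hω
  have hmarkov := mul_meas_ge_le_integral_of_nonneg (μ := P) (f := f)
    (hf.mono fun ω hω ↦ (Real.exp_pos _).le.trans hω) (hi1.add hi2) (Real.exp (h * t))
  have hsub : P.real {ω | t < ‖Z (Fin.last m) ω‖} ≤ P.real {ω | Real.exp (h * t) ≤ f ω} := by
    refine ENNReal.toReal_mono (measure_ne_top _ _) (measure_mono_ae ?_)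
    filter_upwards [hf] with ω hω hlt
    exact (Real.exp_le_exp.2 (mul_le_mul_of_nonneg_left (le_of_lt hlt) hh0)).trans hω
  have hint : ∫ ω, f ω ∂P ≤ 2 * n * Real.exp (h ^ 2 * V) := by
    rw [integral_add hi1 hi2]; linarith
  have hexp : Real.exp (-t ^ 2 / (4 * V)) = Real.exp (h ^ 2 * V) / Real.exp (h * t) := by
    rw [← Real.exp_sub, hdef]; congr 1; field_simp; ring
  rw [hexp, ← mul_div_assoc, le_div_iff₀ (Real.exp_pos _), mul_comm]
  exact (mul_le_mul_of_nonneg_left hsub (Real.exp_pos _).le).trans (hmarkov.trans hint)
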